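/- Let $n\ge 1$. Let $\mathcal C$ be the class of convex functions $\Phi:\mathbb R^n\to\mathbb R\cup\{+\infty\}$ that are even, whose domain $\{\Phi<+\infty\}$ has nonempty interior, and that satisfy $\Phi(x)\to+\infty$ as $|x|\to\infty$. Let $\mathcal C_{1s}$ be the set of $1$-symmetric functions in $\mathcal C$, i.e. those with $\Phi(\epsilon_1x_1,\dots,\epsilon_nx_n)=\Phi(x)=\Phi(x_{\sigma(1)},\dots,x_{\sigma(n)})$ for all $x$, all signs $\epsilon_i\in\{-1,1\}$ and all permutations $\sigma$. Write $\Phi^*(y)=\sup_x(\langle x,y\rangle-\Phi(x))$ for the Legendre transform. A function $f$ on $\mathbb R^n$ is called $s$-homogeneous if $f(\lambda x)=\lambda^s f(x)$ for all $\lambda>0$ and $x\ne 0$. All integrals below are of nonnegative functions and take values in $[0,+\infty]$, with $0\cdot\infty=0$. (1) Let $\alpha,\beta>0$, $s,t>-n$, and let $\rho_1,\rho_2:\mathbb R^n\to[0,\infty)$ be (Lebesgue) measurable, $\rho_1$ being $s$-homogeneous and $\rho_2$ being $t$-homogeneous, with $$\frac{\alpha}{\beta}=\frac{n+s}{n+t}.$$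 Then the functional $$\mathcal{BS}_{\alpha,\beta,\rho_1,\rho_2}(\Phi)=\Bigl(\int_{\mathbb R^n}e^{-\alpha\Phi(x)}\rho_1(x)\,dx\Bigr)^{1/\alpha}\Bigl(\int_{\mathbb R^n}e^{-\beta\Phi^*(y)}\rho_2(y)\,dy\Bigr)^{1/\beta}$$ attains a maximum on $\mathcal C_{1s}$; that is, there is $\Phi_0\in\mathcal C_{1s}$ with $\mathcal{BS}_{\alpha,\beta,\rho_1,\rho_2}(\Psi)\le\mathcal{BS}_{\alpha,\beta,\rho_1,\rho_2}(\Phi_0)$ for all $\Psi\in\mathcal C_{1s}$. If $\rho_1$ and $\rho_2$ are locally integrable, this maximum is finite. (2) Let $p>1$ and let $V:\mathbb R^n\to\mathbb R$ be a $p$-homogeneous convex function. Then the functional $$\mathcal{BS}_{p,V}(\Phi)=\int_{\mathbb R^n}e^{-\Phi(x)}\,dx\,\Bigl(\int_{\mathbb R^n}e^{-\frac1{p-1}\Phi^*(\nabla V(y))}\,dy\Bigr)^{p-1}$$ (where $\nabla V(y)$ exists for almost every $y$) attains a maximum on $\mathcal C_{1s}$. If $V(x)>0$ for all $x\neq0$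 (as is the case when $V$ is strictly convex), this maximum is finite. -/

import Mathlib

open MeasureTheory Filter Topology

noncomputable section

namespace BlaschkeSantalo

/-- `ℝⁿ` with its Euclidean structure. -/
abbrev E (n : ℕ) : Type := EuclideanSpace ℝ (Fin n)

/-- Convexity of an extended-real-valued function: its epigraph is a convex set. -/
def IsConvexFun {n : ℕ} (Φ : E n → EReal) : Prop :=
  Convex ℝ {q : E n × ℝ | Φ q.1 ≤ (q.2 : EReal)}

/-- The effective domain `dom Φ = {x | Φ x < +∞}`. -/
def effDom {n : ℕ} (Φ : E n → EReal) : Set (E n) := {x | Φ x < ⊤}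

/-- The Legendre transform `Φ*(y) = sup_x (⟨x, y⟩ - Φ x)`. -/
def legendre {n : ℕ} (Φ : E n → EReal) (y : E n) : EReal :=
  ⨆ x : E n, (((inner ℝ x y : ℝ) : EReal) - Φ x)

/-- The class `𝒞` of even, coercive convex functions `Φ : ℝⁿ → ℝ ∪ {+∞}` whose domain has
nonempty interior. -/
structure IsClassC {n : ℕ} (Φ : E n → EReal) : Prop where
  ne_bot : ∀ x, Φ x ≠ ⊥
  convex : IsConvexFun Φ
  even : ∀ x, Φ (-x) = Φ x
  interior_dom : (interior (effDom Φ)).Nonempty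
  coercive : Tendsto Φ (cocompact (E n)) (𝓝 ⊤)

/-- `1`-symmetric functions: invariant under all sign changes and all permutations of the
coordinates. -/
def IsOneSymmetric {n : ℕ} (Φ : E n → EReal) : Prop :=
  (∀ (ε : Fin n → ℝ), (∀ i, ε i = 1 ∨ ε i = -1) →
      ∀ x : E n, Φ (WithLp.toLp 2 fun i => ε i * x i) = Φ x) ∧
  (∀ (σ : Equiv.Perm (Fin n)) (x : E n), Φ (WithLp.toLp 2 fun i => x (σ i)) = Φ x)

/-- The set of `1`-symmetric functions in the class `𝒞`. -/
def classOneSymmetric (n : ℕ) : Set (E n → EReal) :=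
  {Φ | IsClassC Φ ∧ IsOneSymmetric Φ}

/-- Positive homogeneity of (real) degree `s`. The value at the origin is not constrained, so
that negative degrees (where `f` is naturally defined only off the origin) are included. -/
def IsHomogeneousOfDegree {n : ℕ} (s : ℝ) (f : E n → ℝ) : Prop :=
  ∀ (r : ℝ) (x : E n), 0 < r → x ≠ 0 → f (r • x) = r ^ s * f x

/-- The weighted Blaschke–Santaló functional
`(∫ e^{-αΦ} ρ₁ dx)^{1/α} (∫ e^{-βΦ*} ρ₂ dy)^{1/β}`, with values in `[0, ∞]`. -/
def BS {n : ℕ} (α β : ℝ) (ρ₁ ρ₂ : E n → ℝ) (Φ : E n → EReal) : ENNReal :=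
  (∫⁻ x, EReal.exp (-((α : EReal) * Φ x)) * ENNReal.ofReal (ρ₁ x)) ^ (1 / α) *
    (∫⁻ y, EReal.exp (-((β : EReal) * legendre Φ y)) * ENNReal.ofReal (ρ₂ y)) ^ (1 / β)

/-- The functional `∫ e^{-Φ} dx (∫ e^{-Φ*(∇V(y))/(p-1)} dy)^{p-1}`, with values in `[0, ∞]`.
It is used for finite convex `V`, for which `∇V(y)` exists for almost every `y`. -/
def BSV {n : ℕ} (p : ℝ) (V : E n → ℝ) (Φ : E n → EReal) : ENNReal :=
  (∫⁻ x, EReal.exp (-Φ x)) *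
    (∫⁻ y, EReal.exp (-(((1 / (p - 1) : ℝ) : EReal) * legendre Φ (gradient V y)))) ^ (p - 1)

end BlaschkeSantalo

end

namespace BlaschkeSantalo

variable {n : ℕ}

/-! ### Convexity for extended-real-valued functions -/

/-! Both functionals are cases of `BSMeasure` for homogeneous measures `μ`, `ν` of degrees `a`, `b`
with `a / α = b / β`. In (1) these are Lebesgue measure weighted by the `ρᵢ`; in (2) they are
Lebesgue measure and its image under `∇V`, which is homogeneous of degree `n / (p - 1)`. The balance
of degrees makes the functional insensitive to `Φ ↦ Φ(r ·) + c` (`BSMeasure_le_normalized`), so a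
supremum over normalized functions is enough (`exists_isNormalized`). For these, convexity and
monotonicity in each `|xᵢ|` give one linear lower bound for both `Φ` and `Φ*`, hence integrable
dominating functions when the unit ball has finite `μ`- and `ν`-measure. Along a maximizing
sequence, take the pointwise limsup `Φ₀` of a subsequence converging at rational points. Reverse
Fatou handles the `ν`-integral, since `Φ₀* ≤ liminf Φₖ*`. For the `μ`-integral, rational points
between `|x|` and `r|x|` give `Φ₀(x) ≤ liminf Φₖ(r x)`, and `r ↓ 1` finishes by homogeneity. If the
unit ball has infinite measure for `μ` or `ν`, the Euclidean norm is a maximizer, with value `0` or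
`∞`. -/

theorem IsConvexFun.le_of_le {Φ : E n → EReal} (h : IsConvexFun Φ) {x y : E n} {c d a b : ℝ}
    (hx : Φ x ≤ c) (hy : Φ y ≤ d) (ha : 0 ≤ a) (hb : 0 ≤ b) (hab : a + b = 1) :
    Φ (a • x + b • y) ≤ ((a * c + b * d : ℝ) : EReal) := by
  have := h (x := (x, c)) hx (y := (y, d)) hy ha hb hab
  simpa using this

/-- Enlarging both bounds by `ε` shows that strict bounds suffice; strictness is what passes from a
limsup to eventual inequalities. -/
theorem isConvexFun_of_lt {Φ : E n → EReal}
    (h : ∀ (x y : E n) (c d a b : ℝ), Φ x < c → Φ y < d → 0 ≤ a → 0 ≤ b → a + b = 1 →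
      Φ (a • x + b • y) ≤ ((a * c + b * d : ℝ) : EReal)) : IsConvexFun Φ := by
  rintro ⟨x, c⟩ hx ⟨y, d⟩ hy a b ha hb hab
  simp only [Set.mem_ofPred_eq, Prod.fst_add, Prod.smul_fst, Prod.snd_add, Prod.smul_snd,
    smul_eq_mul] at hx hy ⊢
  refine EReal.le_of_forall_lt_iff_le.1 fun z hz => ?_
  have hz' : a * c + b * d < z := by exact_mod_cast hz
  set ε := z - (a * c + b * d) with hε
  have hε0 : 0 < ε := by linarith
  have := h x y (c + ε) (d + ε) a b (hx.trans_lt (by exact_mod_cast (by linarith)))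
    (hy.trans_lt (by exact_mod_cast (by linarith))) ha hb hab
  refine this.trans ?_
  norm_cast
  have : a * (c + ε) + b * (d + ε) = a * c + b * d + (a + b) * ε := by ring
  rw [this, hab]
  linarith

theorem IsConvexFun.convex_le {Φ : E n → EReal} (h : IsConvexFun Φ) (c : ℝ) :
    Convex ℝ {x | Φ x ≤ c} := by
  intro x hx y hy a b ha hb hab
  have := h.le_of_le hx hy ha hb hab
  rwa [← add_mul, hab, one_mul] at this

theorem IsConvexFun.convex_lt {Φ : E n → EReal} (h : IsConvexFun Φ) (c : EReal) :
    Convex ℝ {x | Φ x < c} := by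
  intro x hx y hy a b ha hb hab
  obtain ⟨m, hm, hmc⟩ := EReal.lt_iff_exists_real_btwn.1 (max_lt hx hy)
  refine lt_of_le_of_lt ?_ hmc
  exact h.convex_le m ((le_max_left _ _).trans hm.le) ((le_max_right _ _).trans hm.le) ha hb hab

/-- Sublevel sets are convex, and convex sets are null-measurable. Borel measurability may fail, as
no semicontinuity is assumed. -/
theorem IsConvexFun.aemeasurable {Φ : E n → EReal} (h : IsConvexFun Φ) :
    AEMeasurable Φ (volume : Measure (E n)) := by
  refine NullMeasurable.aemeasurable ?_
  exact measurable_of_Iio fun c => (h.convex_lt c).nullMeasurableSet volume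

theorem IsConvexFun.comp_smul {Φ : E n → EReal} (h : IsConvexFun Φ) (r : ℝ) :
    IsConvexFun fun x => Φ (r • x) := by
  refine isConvexFun_of_lt fun x y c d a b hx hy ha hb hab => ?_
  have := h.le_of_le hx.le hy.le ha hb hab
  rwa [smul_comm a, smul_comm b, ← smul_add] at this

theorem IsClassC.apply_zero_le {Φ : E n → EReal} (h : IsClassC Φ) (x : E n) : Φ 0 ≤ Φ x := by
  refine EReal.le_of_forall_lt_iff_le.1 fun c hc => ?_
  have := h.convex.le_of_le hc.le ((h.even x).trans_le hc.le) (a := 1 / 2) (b := 1 / 2)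
    (by norm_num) (by norm_num) (by norm_num)
  rw [smul_neg, add_neg_cancel] at this
  exact this.trans (by norm_cast; linarith)

theorem IsClassC.exists_apply_zero {Φ : E n → EReal} (h : IsClassC Φ) : ∃ c : ℝ, Φ 0 = c := by
  obtain ⟨x, hx⟩ := h.interior_dom
  have hx' : x ∈ effDom Φ := interior_subset hx
  have hx' : Φ x < ⊤ := hx'
  exact ⟨_, (EReal.coe_toReal ((h.apply_zero_le x).trans_lt hx').ne (h.ne_bot 0)).symm⟩

/-- A convex function that is invariant under sign changes is monotone in the absolute values
of the coordinates. -/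
theorem IsConvexFun.le_of_abs_le {Φ : E n → EReal} (h : IsConvexFun Φ) (hs : IsOneSymmetric Φ)
    {x y : E n} (hxy : ∀ i, |x i| ≤ |y i|) : Φ x ≤ Φ y := by
  classical
  refine EReal.le_of_forall_lt_iff_le.1 fun c hc => ?_
  -- Coordinates of `y` are replaced by those of `x` one at a time: `x j` lies between `y j` and `-y
  -- j`, and a sign flip gives the other endpoint.
  have key : ∀ S : Finset (Fin n),
      Φ (WithLp.toLp 2 fun i => if i ∈ S then x i else y i) ≤ c := by
    intro S
    induction S using Finset.induction_on with
    | empty => simpa using hc.le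
    | insert j S hj ih =>
      set z : E n := WithLp.toLp 2 fun i => if i ∈ S then x i else y i with hz
      set ε : Fin n → ℝ := fun i => if i = j then -1 else 1 with hε
      have hflip : Φ (WithLp.toLp 2 fun i => ε i * z i) ≤ c := by
        rw [hs.1 ε (fun i => by by_cases hi : i = j <;> simp [hε, hi]) z]
        exact ih
      obtain ⟨t, ht0, ht1, ht⟩ : ∃ t : ℝ, 0 ≤ t ∧ t ≤ 1 ∧ x j = t * y j + (1 - t) * (-y j) := by
        by_cases hy : y j = 0
        · refine ⟨0, le_rfl, zero_le_one, ?_⟩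
          have := hxy j
          simp only [hy, abs_zero, abs_nonpos_iff] at this
          simp [this, hy]
        · have hq : |x j / y j| ≤ 1 := by
            rw [abs_div]; exact div_le_one_of_le₀ (hxy j) (abs_nonneg _)
          rw [abs_le] at hq
          refine ⟨(1 + x j / y j) / 2, by linarith, by linarith, ?_⟩
          field_simp
          ring
      have := h.convex_le c ih hflip ht0 (sub_nonneg.2 ht1) (by ring)
      refine le_of_eq_of_le (congrArg Φ ?_) this
      ext i
      by_cases hi : i = j
      · subst hi
        simp [hε, hz, hj, ht]
      · simp only [Finset.mem_insert, hi, false_or, hε, if_false, PiLp.add_apply, PiLp.smul_apply,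
          smul_eq_mul, hz]
        ring
  simpa using key Finset.univ

theorem IsOneSymmetric.apply_single_eq {Φ : E n → EReal} (hs : IsOneSymmetric Φ) (i j : Fin n)
    (t : ℝ) : Φ (EuclideanSpace.single i t) = Φ (EuclideanSpace.single j t) := by
  rw [← hs.2 (Equiv.swap i j) (EuclideanSpace.single j t)]
  congr 1
  ext k
  simp [Equiv.swap_apply_eq_iff]

/-! ### The exponential weight -/

/-- The weight `e^{-av}` for an extended real `v`. -/
noncomputable def expNeg (a : ℝ) (v : EReal) : ENNReal := EReal.exp (-((a : EReal) * v))

theorem expNeg_antitone {a : ℝ} (ha : 0 ≤ a) : Antitone (expNeg a) := fun _ _ h =>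
  EReal.exp_monotone (EReal.neg_le_neg_iff.2 (mul_le_mul_of_nonneg_left h (by exact_mod_cast ha)))

@[simp] theorem expNeg_coe (a v : ℝ) : expNeg a v = ENNReal.ofReal (Real.exp (-(a * v))) := by
  simp only [expNeg]
  norm_cast

theorem continuous_expNeg {a : ℝ} (ha : 0 < a) : Continuous (expNeg a) := by
  refine ENNReal.continuous_exp.comp (continuous_neg.comp ?_)
  rw [continuous_iff_continuousAt]
  intro v
  have h := EReal.continuousAt_mul (p := ((a : EReal), v)) (by simp [ha.ne']) (by simp [ha.ne'])
    (by simp) (by simp)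
  exact h.comp (f := fun v : EReal => ((a : EReal), v)) (by fun_prop)

theorem measurable_expNeg {a : ℝ} (ha : 0 < a) : Measurable (expNeg a) :=
  (continuous_expNeg ha).measurable

theorem expNeg_add_coe {a : ℝ} (ha : 0 < a) (v : EReal) (c : ℝ) :
    expNeg a (v + c) = expNeg a v * ENNReal.ofReal (Real.exp (-(a * c))) := by
  rw [← expNeg_coe, expNeg, expNeg, expNeg, ← EReal.exp_add]
  congr 1
  induction v with
  | bot =>
    simp [EReal.coe_mul_bot_of_pos ha, EReal.top_add_of_ne_bot, ← EReal.coe_mul, ← EReal.coe_neg]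
  | top => simp [EReal.coe_mul_top_of_pos ha]
  | coe v => norm_cast; ring

/-! ### Measurability of the Legendre transform -/

theorem le_legendre (Φ : E n → EReal) (x y : E n) :
    ((inner ℝ x y : ℝ) : EReal) - Φ x ≤ legendre Φ y :=
  le_iSup (fun x : E n => ((inner ℝ x y : ℝ) : EReal) - Φ x) x

theorem measurable_legendre (Φ : E n → EReal) : Measurable (legendre Φ) := by
  refine LowerSemicontinuous.measurable ?_
  refine lowerSemicontinuous_iSup fun x => ?_
  have hin : Continuous fun y : E n => (inner ℝ x y : ℝ) := by fun_prop
  induction hx : Φ x with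
  | bot => simpa using lowerSemicontinuous_const
  | top => simpa using lowerSemicontinuous_const
  | coe c =>
    norm_cast
    exact (continuous_coe_real_ereal.comp (hin.sub continuous_const)).lowerSemicontinuous

/-! ### Homogeneous measures -/

/-- A measure on `ℝⁿ` is homogeneous of degree `a` if dilating a set by `r > 0` multiplies its
measure by `r ^ a`. -/
def IsHomogeneousMeasure (a : ℝ) (μ : Measure (E n)) : Prop :=
  ∀ r : ℝ, 0 < r → μ.map (r • ·) = ENNReal.ofReal (r ^ (-a)) • μ

namespace IsHomogeneousMeasure

variable {a : ℝ} {μ : Measure (E n)}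

theorem lintegral_comp_smul (h : IsHomogeneousMeasure a μ) {r : ℝ} (hr : 0 < r)
    (f : E n → ENNReal) :
    ∫⁻ x, f (r • x) ∂μ = ENNReal.ofReal (r ^ (-a)) * ∫⁻ x, f x ∂μ := by
  rw [← (measurableEmbedding_const_smul₀ hr.ne').lintegral_map f, h r hr, lintegral_smul_measure,
    smul_eq_mul]

theorem closedBall_eq (h : IsHomogeneousMeasure a μ) {r : ℝ} (hr : 0 < r) :
    μ (Metric.closedBall 0 r) = ENNReal.ofReal (r ^ a) * μ (Metric.closedBall 0 1) := by
  have h1 := congrArg (fun m : Measure (E n) => m (Metric.closedBall 0 1)) (h r⁻¹ (inv_pos.2 hr))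
  simp only [Measure.smul_apply, smul_eq_mul] at h1
  rw [(measurableEmbedding_const_smul₀ (inv_pos.2 hr).ne').map_apply, Real.inv_rpow hr.le,
    Real.rpow_neg hr.le, inv_inv] at h1
  rw [← h1]
  congr 1
  ext x
  simp only [Metric.mem_closedBall, dist_zero_right, Set.mem_preimage, norm_smul, norm_inv,
    Real.norm_eq_abs, abs_of_pos hr]
  rw [inv_mul_le_iff₀ hr, mul_one]

theorem eq_zero (h : IsHomogeneousMeasure a μ) (h0 : μ (Metric.closedBall 0 1) = 0) : μ = 0 := by
  rw [← Measure.measure_univ_eq_zero, ← Metric.iUnion_closedBall_nat (0 : E n)]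
  refine measure_iUnion_null fun k => ?_
  -- The radius is enlarged to `k + 1` because scaling needs it to be positive.
  refine measure_mono_null (Metric.closedBall_subset_closedBall (Nat.cast_le.2 k.le_succ)) ?_
  rw [h.closedBall_eq (by positivity), h0, mul_zero]

/-- Balls of radius `k + 1` have measure at most a constant times `(k + 1) ^ N` with `N ≥ a`, which
the exponential beats. -/
theorem lintegral_exp_neg_norm_lt_top (h : IsHomogeneousMeasure a μ)
    (hfin : μ (Metric.closedBall 0 1) < ⊤) {c : ℝ} (hc : 0 < c) :
    ∫⁻ x, ENNReal.ofReal (Real.exp (-(c * ‖x‖))) ∂μ < ⊤ := by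
  obtain ⟨N, hN⟩ := exists_nat_ge a
  have hpt : ∀ x : E n, ENNReal.ofReal (Real.exp (-(c * ‖x‖))) ≤
      ∑' k : ℕ, (Metric.closedBall (0 : E n) (k + 1 : ℝ)).indicator
        (fun _ => ENNReal.ofReal (Real.exp (-(c * k)))) x := by
    intro x
    refine le_trans ?_ (ENNReal.le_tsum ⌊‖x‖⌋₊)
    rw [Set.indicator_of_mem]
    · gcongr
      exact Nat.floor_le (norm_nonneg x)
    · simpa using (Nat.lt_floor_add_one ‖x‖).le
  refine (lintegral_mono hpt).trans_lt ?_
  rw [lintegral_tsum fun k =>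
    (measurable_const.indicator Metric.isClosed_closedBall.measurableSet).aemeasurable]
  have hterm : ∀ k : ℕ, ∫⁻ x, (Metric.closedBall (0 : E n) (k + 1 : ℝ)).indicator
        (fun _ => ENNReal.ofReal (Real.exp (-(c * k)))) x ∂μ ≤
      ENNReal.ofReal (Real.exp c * (((k + 1 : ℕ) : ℝ) ^ N * Real.exp (-c * (k + 1 : ℕ)))) *
        μ (Metric.closedBall 0 1) := by
    intro k
    rw [lintegral_indicator_const Metric.isClosed_closedBall.measurableSet,
      h.closedBall_eq (by positivity), ← mul_assoc, ← ENNReal.ofReal_mul (Real.exp_nonneg _)]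
    have : Real.exp c * (((k + 1 : ℕ) : ℝ) ^ N * Real.exp (-c * (k + 1 : ℕ))) =
        Real.exp (-(c * k)) * ((k : ℝ) + 1) ^ N := by
      rw [mul_left_comm, ← Real.exp_add, mul_comm]
      push_cast
      congr 2
      ring
    rw [this, ← Real.rpow_natCast]
    gcongr
    simp
  refine (ENNReal.tsum_le_tsum hterm).trans_lt ?_
  rw [ENNReal.tsum_mul_right]
  refine ENNReal.mul_lt_top ?_ hfin
  have hs : Summable fun k : ℕ =>
      Real.exp c * (((k + 1 : ℕ) : ℝ) ^ N * Real.exp (-c * (k + 1 : ℕ))) :=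
    (((summable_nat_add_iff 1).2 (Real.summable_pow_mul_exp_neg_nat_mul N hc))).mul_left _
  exact hs.tsum_ofReal_lt_top

end IsHomogeneousMeasure

theorem isHomogeneousMeasure_volume : IsHomogeneousMeasure (n : ℝ) (volume : Measure (E n)) := by
  intro r hr
  rw [Measure.map_addHaar_smul _ hr.ne', finrank_euclideanSpace_fin,
    abs_of_pos (by positivity), Real.rpow_neg hr.le, Real.rpow_natCast]

theorem isHomogeneousMeasure_withDensity (hn : 0 < n) {s : ℝ} {ρ : E n → ℝ}
    (hρ : IsHomogeneousOfDegree s ρ) :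
    IsHomogeneousMeasure (n + s) ((volume : Measure (E n)).withDensity fun x =>
      ENNReal.ofReal (ρ x)) := by
  -- This makes the origin null, where homogeneity says nothing.
  have : Nontrivial (E n) := by
    have : Nonempty (Fin n) := ⟨⟨0, hn⟩⟩
    infer_instance
  intro r hr
  ext A hA
  have hA' : MeasurableSet ((r • ·) ⁻¹' A : Set (E n)) := measurable_const_smul r hA
  rw [(measurableEmbedding_const_smul₀ hr.ne').map_apply, withDensity_apply _ hA',
    Measure.smul_apply, withDensity_apply _ hA, ← lintegral_indicator hA', ← lintegral_indicator hA]
  have hae : ∀ᵐ x : E n, ((r • ·) ⁻¹' A).indicator (fun x => ENNReal.ofReal (ρ x)) x =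
      ENNReal.ofReal (r ^ (-s)) * A.indicator (fun x => ENNReal.ofReal (ρ x)) (r • x) := by
    filter_upwards [Measure.ae_ne volume (0 : E n)] with x hx
    by_cases hxA : r • x ∈ A
    · rw [Set.indicator_of_mem (show x ∈ (r • ·) ⁻¹' A from hxA), Set.indicator_of_mem hxA,
        hρ r x hr hx, ← ENNReal.ofReal_mul (by positivity), ← mul_assoc, ← Real.rpow_add hr]
      simp
    · rw [Set.indicator_of_notMem (show x ∉ (r • ·) ⁻¹' A from hxA), Set.indicator_of_notMem hxA,
        mul_zero]
  rw [lintegral_congr_ae hae, lintegral_const_mul' _ _ ENNReal.ofReal_ne_top,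
    isHomogeneousMeasure_volume.lintegral_comp_smul hr, ← mul_assoc,
    ← ENNReal.ofReal_mul (by positivity),
    ← Real.rpow_add hr, smul_eq_mul]
  congr 3
  ring

/-! ### The push-forward of Lebesgue measure by the gradient of a homogeneous convex function -/

theorem measurable_gradient (V : E n → ℝ) : Measurable (gradient V) :=
  (InnerProductSpace.toDual ℝ (E n)).symm.continuous.measurable.comp (measurable_fderiv ℝ V)

/-- A finite convex function is Lipschitz on balls, so Rademacher's theorem applies there. -/
theorem ae_differentiableAt_of_convexOn {V : E n → ℝ} (hV : ConvexOn ℝ Set.univ V) :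
    ∀ᵐ x : E n, DifferentiableAt ℝ V x := by
  have h : ∀ k : ℕ, ∀ᵐ x : E n, x ∈ Metric.closedBall (0 : E n) k →
      DifferentiableWithinAt ℝ V (Metric.closedBall 0 k) x := by
    intro k
    obtain ⟨K, hK⟩ := (hV.locallyLipschitz.locallyLipschitzOn
      (s := Metric.closedBall (0 : E n) k)).exists_lipschitzOnWith_of_compact
        (isCompact_closedBall _ _)
    exact hK.ae_differentiableWithinAt_of_mem
  filter_upwards [ae_all_iff.2 h] with x hx
  obtain ⟨k, hk⟩ := exists_nat_gt ‖x‖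
  refine (hx k (by simpa using hk.le)).differentiableAt ?_
  exact mem_of_superset (Metric.isOpen_ball.mem_nhds (by simpa using hk)) Metric.ball_subset_closedBall

section Homogeneous

variable {p : ℝ} {V : E n → ℝ}

theorem IsHomogeneousOfDegree.apply_zero (hn : 0 < n) (hp : 0 < p) (hV : Continuous V)
    (h : IsHomogeneousOfDegree p V) : V 0 = 0 := by
  set x : E n := EuclideanSpace.single ⟨0, hn⟩ 1 with hx
  have hx0 : x ≠ 0 := by simp [hx]
  have h1 : Tendsto (fun r : ℝ => V (r • x)) (𝓝[>] 0) (𝓝 (V 0)) := by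
    have : Continuous fun r : ℝ => V (r • x) := by fun_prop
    simpa using (this.tendsto 0).mono_left nhdsWithin_le_nhds
  have h2 : Tendsto (fun r : ℝ => r ^ p * V x) (𝓝[>] 0) (𝓝 0) := by
    have : Continuous fun r : ℝ => r ^ p * V x := (Real.continuous_rpow_const hp.le).mul_const _
    simpa [Real.zero_rpow hp.ne'] using (this.tendsto 0).mono_left nhdsWithin_le_nhds
  refine tendsto_nhds_unique h1 (h2.congr' ?_)
  filter_upwards [self_mem_nhdsWithin] with r hr
  exact (h r x hr hx0).symm

theorem IsHomogeneousOfDegree.gradient_smul (h : IsHomogeneousOfDegree p V) (h0 : V 0 = 0)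
    {r : ℝ} (hr : 0 < r) (x : E n) : gradient V (r • x) = r ^ (p - 1) • gradient V x := by
  have hV : (fun y => V (r • y)) = r ^ p • V := by
    ext y
    by_cases hy : y = 0
    · simp [hy, h0]
    · simpa using h r y hr hy
  have h1 : fderiv ℝ (fun y => V (r • y)) x = r • fderiv ℝ V (r • x) := fderiv_comp_smul ..
  rw [hV, fderiv_const_smul_field] at h1
  have h2 : fderiv ℝ V (r • x) = r ^ (p - 1) • fderiv ℝ V x := by
    rw [Real.rpow_sub_one hr.ne', div_eq_inv_mul, mul_smul]
    rw [eq_inv_smul_iff₀ hr.ne', ← h1]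
    rfl
  rw [gradient, gradient, h2, map_smulₛₗ]
  rfl

theorem IsHomogeneousOfDegree.inner_gradient (h : IsHomogeneousOfDegree p V) {x : E n}
    (hx : x ≠ 0) (hd : DifferentiableAt ℝ V x) : inner ℝ (gradient V x) x = p * V x := by
  have h1 : HasDerivAt (fun r : ℝ => V (r • x)) (fderiv ℝ V x x) 1 := by
    have hl : HasDerivAt (fun r : ℝ => r • x) x 1 := by
      simpa using (hasDerivAt_id (1 : ℝ)).smul_const x
    have hf : HasFDerivAt V (fderiv ℝ V x) ((1 : ℝ) • x) := by simpa using hd.hasFDerivAt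
    exact hf.comp_hasDerivAt (1 : ℝ) hl
  have h2 : HasDerivAt (fun r : ℝ => r ^ p * V x) (p * V x) 1 := by
    simpa using (Real.hasDerivAt_rpow_const (x := 1) (p := p) (.inl one_ne_zero)).mul_const (V x)
  have h3 : HasDerivAt (fun r : ℝ => V (r • x)) (p * V x) 1 := by
    refine h2.congr_of_eventuallyEq ?_
    filter_upwards [lt_mem_nhds (zero_lt_one (α := ℝ))] with r hr
    exact h r x hr hx
  rw [← h1.unique h3, gradient, InnerProductSpace.toDual_symm_apply]

/-- Since `∇V` is `(p - 1)`-homogeneous, dilating its values by `r` is dilating its argument by `q =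
r ^ (1 / (p - 1))`. -/
theorem isHomogeneousMeasure_map_gradient (hn : 0 < n) (hp : 1 < p)
    (hV : ConvexOn ℝ Set.univ V) (h : IsHomogeneousOfDegree p V) :
    IsHomogeneousMeasure (n / (p - 1)) ((volume : Measure (E n)).map (gradient V)) := by
  have hp1 : 0 < p - 1 := sub_pos.2 hp
  have h0 := h.apply_zero hn (by linarith) hV.locallyLipschitz.continuous
  intro r hr
  set q := r ^ (1 / (p - 1)) with hq
  have hq0 : 0 < q := Real.rpow_pos_of_pos hr _
  have hqr : q ^ (p - 1) = r := by
    rw [hq, ← Real.rpow_mul hr.le, one_div_mul_cancel hp1.ne', Real.rpow_one]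
  have hcomp : (r • ·) ∘ gradient V = gradient V ∘ (q • · : E n → E n) := by
    ext1 x
    simp only [Function.comp_apply]
    rw [h.gradient_smul h0 hq0, hqr]
  rw [Measure.map_map (measurable_const_smul r) (measurable_gradient V), hcomp,
    ← Measure.map_map (measurable_gradient V) (measurable_const_smul q),
    isHomogeneousMeasure_volume q hq0, Measure.map_smul, hq, ← Real.rpow_mul hr.le]
  congr 3
  ring

/-- With `m > 0` the minimum of `V` on the unit sphere, Euler's identity gives `p m ‖x‖ ^ p ≤ p V x
≤ ‖∇V x‖ ‖x‖`, so `‖∇V x‖ ≤ 1` bounds `‖x‖`. -/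
theorem map_gradient_closedBall_lt_top (hn : 0 < n) (hp : 1 < p)
    (hV : ConvexOn ℝ Set.univ V) (h : IsHomogeneousOfDegree p V) (hpos : ∀ x, x ≠ 0 → 0 < V x) :
    (volume : Measure (E n)).map (gradient V) (Metric.closedBall 0 1) < ⊤ := by
  have hp1 : 0 < p - 1 := sub_pos.2 hp
  have hcont := hV.locallyLipschitz.continuous
  have hne : (Metric.sphere (0 : E n) 1).Nonempty :=
    ⟨EuclideanSpace.single ⟨0, hn⟩ 1, by simp⟩
  obtain ⟨z, hz, hmin⟩ := (isCompact_sphere (0 : E n) 1).exists_isMinOn hne hcont.continuousOn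
  have hz0 : 0 < V z := hpos z (by rintro rfl; simp at hz)
  have hlow : ∀ x : E n, x ≠ 0 → ‖x‖ ^ p * V z ≤ V x := by
    intro x hx
    have hx' : 0 < ‖x‖ := norm_pos_iff.2 hx
    have hs : ‖x‖⁻¹ • x ∈ Metric.sphere (0 : E n) 1 := by
      simp [norm_smul, hx'.ne']
    have h1 := h ‖x‖ (‖x‖⁻¹ • x) hx' (by simp [hx, hx'.ne'])
    rw [smul_inv_smul₀ hx'.ne'] at h1
    rw [h1]
    exact mul_le_mul_of_nonneg_left (hmin hs) (by positivity)
  rw [Measure.map_apply (measurable_gradient V) Metric.isClosed_closedBall.measurableSet]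
  set R : ℝ := (1 / (p * V z)) ^ (1 / (p - 1)) with hR
  refine lt_of_le_of_lt (measure_mono_ae (t := Metric.closedBall 0 R) ?_)
    (isCompact_closedBall _ _).measure_lt_top
  filter_upwards [ae_differentiableAt_of_convexOn hV] with x hd hx
  change x ∈ Metric.closedBall 0 R
  have hx1 : ‖gradient V x‖ ≤ 1 := by
    have : gradient V x ∈ Metric.closedBall 0 1 := hx
    simpa using this
  have hppos : 0 < p := by linarith
  rw [mem_closedBall_zero_iff]
  by_cases hx0 : x = 0
  · rw [hx0, norm_zero]; positivity
  have hx' : 0 < ‖x‖ := norm_pos_iff.2 hx0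
  have h1 := h.inner_gradient hx0 hd
  have h2 := real_inner_le_norm (gradient V x) x
  have h3 : ‖x‖ ^ p = ‖x‖ ^ (p - 1) * ‖x‖ := by
    rw [← Real.rpow_add_one hx'.ne', sub_add_cancel]
  have h4 : ‖x‖ ^ (p - 1) * (p * V z) * ‖x‖ ≤ 1 * ‖x‖ := by
    calc ‖x‖ ^ (p - 1) * (p * V z) * ‖x‖ = p * (‖x‖ ^ p * V z) := by rw [h3]; ring
      _ ≤ p * V x := mul_le_mul_of_nonneg_left (hlow x hx0) hppos.le
      _ ≤ ‖gradient V x‖ * ‖x‖ := h1 ▸ h2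
      _ ≤ 1 * ‖x‖ := by gcongr
  have h5 := le_of_mul_le_mul_right h4 hx'
  rw [← le_div_iff₀ (by positivity)] at h5
  calc ‖x‖ = (‖x‖ ^ (p - 1)) ^ (1 / (p - 1)) := by
        rw [← Real.rpow_mul hx'.le, mul_one_div_cancel hp1.ne', Real.rpow_one]
    _ ≤ R := Real.rpow_le_rpow (by positivity) h5 (by positivity)

end Homogeneous

/-! ### Normalized functions -/

/-- The constant `1 / (2n)` of the two-sided bounds for normalized functions. -/
noncomputable def normConst (n : ℕ) : ℝ := 1 / (2 * n)

theorem normConst_pos (hn : 0 < n) : 0 < normConst n := by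
  have : (0 : ℝ) < n := by exact_mod_cast hn
  rw [normConst]; positivity

/-- A convex, `1`-symmetric function bounded below by `‖x‖ / (2n) - 1` everywhere, and above
by `1` on the ball of radius `1 / (2n)`. -/
structure IsNormalized (Φ : E n → EReal) : Prop where
  convex : IsConvexFun Φ
  symm : IsOneSymmetric Φ
  lower : ∀ x, ((normConst n * ‖x‖ - 1 : ℝ) : EReal) ≤ Φ x
  upper : ∀ x, ‖x‖ ≤ normConst n → Φ x ≤ ((1 : ℝ) : EReal)

theorem IsOneSymmetric.even {Φ : E n → EReal} (h : IsOneSymmetric Φ) (x : E n) :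
    Φ (-x) = Φ x := by
  rw [← h.1 (fun _ => -1) (by simp) x]
  congr 1
  ext i
  simp

theorem tendsto_top_of_le_norm {Φ : E n → EReal} {c d : ℝ} (hc : 0 < c)
    (h : ∀ x, ((c * ‖x‖ - d : ℝ) : EReal) ≤ Φ x) : Tendsto Φ (cocompact (E n)) (𝓝 ⊤) := by
  rw [EReal.tendsto_nhds_top_iff_real]
  intro m
  filter_upwards [(tendsto_norm_cocompact_atTop (E := E n)).eventually_gt_atTop ((m + d) / c)]
    with x hx
  refine lt_of_lt_of_le ?_ (h x)
  rw [div_lt_iff₀ hc] at hx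
  norm_cast
  linarith

theorem IsNormalized.mem (hn : 0 < n) {Φ : E n → EReal} (h : IsNormalized Φ) :
    Φ ∈ classOneSymmetric n := by
  refine ⟨⟨fun x => ?_, h.convex, h.symm.even, ?_, ?_⟩, h.symm⟩
  · exact ((EReal.bot_lt_coe _).trans_le (h.lower x)).ne'
  · refine ⟨0, mem_interior.2 ⟨Metric.ball 0 (normConst n), fun x hx => ?_, Metric.isOpen_ball,
      Metric.mem_ball_self (normConst_pos hn)⟩⟩
    exact (h.upper x (by simpa using (Metric.mem_ball.1 hx).le)).trans_lt (EReal.coe_lt_top 1)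
  · exact tendsto_top_of_le_norm (normConst_pos hn) h.lower

/-- The supremum is tested at the vector of length `normConst n` along `y`, where `Φ ≤ 1`. -/
theorem IsNormalized.le_legendre (hn : 0 < n) {Φ : E n → EReal} (h : IsNormalized Φ) (y : E n) :
    ((normConst n * ‖y‖ - 1 : ℝ) : EReal) ≤ legendre Φ y := by
  have hc := normConst_pos hn
  set x : E n := (normConst n / ‖y‖) • y with hx
  have hxn : ‖x‖ ≤ normConst n := by
    rw [hx, norm_smul, norm_div, norm_norm, Real.norm_eq_abs, abs_of_pos hc]
    by_cases hy : ‖y‖ = 0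
    · simp [hy, hc.le]
    · rw [div_mul_cancel₀ _ hy]
  have hin : inner ℝ x y = normConst n * ‖y‖ := by
    rw [hx, real_inner_smul_left, real_inner_self_eq_norm_sq]
    by_cases hy : ‖y‖ = 0
    · simp [hy]
    · field_simp
  refine le_trans ?_ (BlaschkeSantalo.le_legendre Φ x y)
  rw [hin, EReal.coe_sub]
  exact EReal.sub_le_sub le_rfl (h.upper x hxn)

theorem exists_norm_le_mul_abs (hn : 0 < n) (x : E n) : ∃ i, ‖x‖ ≤ n * |x i| := by
  have : Nonempty (Fin n) := ⟨⟨0, hn⟩⟩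
  obtain ⟨i, hi⟩ := Finite.exists_max fun i => |x i|
  refine ⟨i, ?_⟩
  rw [EuclideanSpace.norm_eq]
  have h1 : ∑ j, ‖x j‖ ^ 2 ≤ (n * |x i|) ^ 2 := by
    calc ∑ j, ‖x j‖ ^ 2 ≤ ∑ _j : Fin n, |x i| ^ 2 :=
          Finset.sum_le_sum fun j _ => pow_le_pow_left₀ (norm_nonneg _) (hi j) 2
      _ = n * |x i| ^ 2 := by simp
      _ ≤ (n * |x i|) ^ 2 := by
        rw [mul_pow]
        gcongr
        have : (1 : ℝ) ≤ n := by exact_mod_cast hn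
        nlinarith
  exact Real.sqrt_le_iff.2 ⟨by positivity, h1⟩

/-- Two bounds on a coordinate axis suffice for a function to be normalized. -/
theorem isNormalized_of_axis (hn : 0 < n) {Φ : E n → EReal} (hconv : IsConvexFun Φ)
    (hsymm : IsOneSymmetric Φ) (h0 : Φ 0 = 0) (hnonneg : ∀ x, 0 ≤ Φ x) (i : Fin n)
    (hle : Φ (EuclideanSpace.single i (1 / 2)) ≤ ((1 : ℝ) : EReal))
    (hge : ((1 : ℝ) : EReal) ≤ Φ (EuclideanSpace.single i 2)) : IsNormalized Φ := by
  have hn' : (0 : ℝ) < n := by exact_mod_cast hn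
  refine ⟨hconv, hsymm, fun x => ?_, fun x hx => ?_⟩
  · obtain ⟨j, hj⟩ := exists_norm_le_mul_abs hn x
    have hxj : normConst n * ‖x‖ ≤ |x j| / 2 := by
      rw [normConst, one_div_mul_eq_div, div_le_div_iff₀ (by positivity) two_pos]
      nlinarith
    -- Beyond `2` on the axis, convexity with `Φ 0 = 0` forces `Φ ≥ |x j| / 2`; below `2` the
    -- claimed bound is negative.
    rcases le_or_gt 2 |x j| with h2 | h2
    · have hmono : Φ (EuclideanSpace.single j |x j|) ≤ Φ x := by
        refine hconv.le_of_abs_le hsymm fun k => ?_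
        by_cases hk : k = j
        · subst hk; simp
        · simp [hk]
      refine le_trans ?_ hmono
      refine EReal.le_of_forall_lt_iff_le.1 fun c hc => ?_
      have hpos : 0 < |x j| := by linarith
      have hcomb := hconv.le_of_le (x := EuclideanSpace.single j |x j|) (y := 0) (d := 0) hc.le
        (by simp [h0]) (a := 2 / |x j|) (b := 1 - 2 / |x j|) (by positivity)
        (by rw [sub_nonneg, div_le_one hpos]; exact h2) (by ring)
      have heq : (2 / |x j|) • EuclideanSpace.single j |x j| + (1 - 2 / |x j|) • (0 : E n) =
          EuclideanSpace.single j 2 := by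
        ext k
        by_cases hk : k = j
        · subst hk; simp [hpos.ne']
        · simp [hk]
      rw [heq, hsymm.apply_single_eq j i] at hcomb
      have h1 := EReal.coe_le_coe_iff.1 (hge.trans hcomb)
      rw [mul_zero, add_zero, div_mul_eq_mul_div, le_div_iff₀ hpos] at h1
      norm_cast
      linarith
    · refine le_trans ?_ (hnonneg x)
      norm_cast
      linarith
  -- The diagonal point is the mean of the points `e_j / 2`, and it dominates the small ball
  -- coordinatewise.
  · have hw : Φ (WithLp.toLp 2 fun _ => normConst n) ≤ ((1 : ℝ) : EReal) := by
      have := (hconv.convex_le 1).sum_mem (t := Finset.univ) (w := fun _ : Fin n => (1 / n : ℝ))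
        (z := fun j => EuclideanSpace.single j (1 / 2 : ℝ)) (fun _ _ => by positivity)
        (by simp [hn'.ne']) (fun j _ => by
          change Φ _ ≤ _
          rw [hsymm.apply_single_eq j i]; exact hle)
      refine le_of_eq_of_le (congrArg Φ ?_) this
      ext k
      simp [normConst, mul_comm, Pi.single_apply]
    refine le_trans (hconv.le_of_abs_le hsymm fun k => ?_) hw
    calc |x k| ≤ ‖x‖ := PiLp.norm_apply_le x k
      _ ≤ normConst n := hx
      _ ≤ _ := le_abs_self _

/-- The union of the coordinate hyperplanes is Lebesgue-null. -/
theorem ae_forall_apply_ne_zero : ∀ᵐ x : E n, ∀ i, x i ≠ 0 := by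
  rw [ae_all_iff]
  intro i
  let l : E n →L[ℝ] ℝ := EuclideanSpace.proj i
  have : (LinearMap.ker l.toLinearMap) ≠ ⊤ := by
    intro h
    have h1 : EuclideanSpace.single i (1 : ℝ) ∈ LinearMap.ker l.toLinearMap := h ▸ Submodule.mem_top
    simp [l] at h1
  have h0 := Measure.addHaar_submodule (volume : Measure (E n)) _ this
  rw [ae_iff]
  refine measure_mono_null (fun x hx => ?_) h0
  have hx' : ¬ (x i ≠ 0) := hx
  rw [not_not] at hx'
  simpa [l] using hx'

/-- An interior point of the domain can be chosen off the coordinate hyperplanes; shrinking it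
brings `Φ` below `c` by convexity, and monotonicity then projects it onto an axis. -/
theorem exists_single_le {Φ : E n → EReal} (h : Φ ∈ classOneSymmetric n)
    (i : Fin n) {c : ℝ} (hc : Φ 0 < c) :
    ∃ t : ℝ, 0 < t ∧ Φ (EuclideanSpace.single i t) ≤ c := by
  obtain ⟨y, hy, hy0⟩ : ∃ y ∈ interior (effDom Φ), ∀ i, y i ≠ 0 := by
    have hpos := isOpen_interior.measure_pos (volume : Measure (E n)) h.1.interior_dom
    by_contra! hcon
    refine hpos.ne' (measure_mono_null (fun x hx => ?_) (ae_iff.1 (ae_forall_apply_ne_zero (n := n))))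
    change ¬ _
    push Not
    exact hcon x hx
  have hyd : y ∈ effDom Φ := interior_subset hy
  have hyd : Φ y < ⊤ := hyd
  obtain ⟨m, hm, -⟩ := EReal.lt_iff_exists_real_btwn.1 hyd
  obtain ⟨c₀, hc₀⟩ := h.1.exists_apply_zero
  rw [hc₀] at hc
  have hcc : c₀ < c := by exact_mod_cast hc
  set s : ℝ := (c - c₀) / (c - c₀ + |m - c₀|) with hs
  have hden : 0 < c - c₀ + |m - c₀| := by have := abs_nonneg (m - c₀); linarith
  have hs0 : 0 < s := div_pos (by linarith) hden
  have hs1 : s ≤ 1 := by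
    rw [hs, div_le_one hden]; have := abs_nonneg (m - c₀); linarith
  refine ⟨s * |y i|, mul_pos hs0 (abs_pos.2 (hy0 i)), ?_⟩
  have h1 := h.1.convex.le_of_le hm.le hc₀.le hs0.le (sub_nonneg.2 hs1) (by ring)
  refine (h.1.convex.le_of_abs_le h.2 fun k => ?_).trans (h1.trans ?_)
  · by_cases hk : k = i
    · subst hk; simp [abs_mul]
    · simp [hk]
      positivity
  · norm_cast
    have h2 : s * (m - c₀) ≤ c - c₀ := by
      calc s * (m - c₀) ≤ s * (c - c₀ + |m - c₀|) := by
            gcongr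
            have := le_abs_self (m - c₀)
            linarith
        _ = c - c₀ := div_mul_cancel₀ _ hden.ne'
    linarith

/-- Every function of the class becomes normalized after a dilation and the addition of a
constant. -/
theorem exists_isNormalized (hn : 0 < n) {Φ : E n → EReal} (h : Φ ∈ classOneSymmetric n) :
    ∃ r : ℝ, 0 < r ∧ ∃ c : ℝ, IsNormalized fun x => Φ (r • x) + (c : EReal) := by
  obtain ⟨c₀, hc₀⟩ := h.1.exists_apply_zero
  set i : Fin n := ⟨0, hn⟩
  have hlt : Φ 0 < ((c₀ + 1 : ℝ) : EReal) := by rw [hc₀]; norm_cast; linarith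
  set T : Set ℝ := {t | 0 ≤ t ∧ Φ (EuclideanSpace.single i t) ≤ ((c₀ + 1 : ℝ) : EReal)} with hT
  obtain ⟨t₀, ht₀, ht₀T⟩ := exists_single_le h i hlt
  have hmem : t₀ ∈ T := ⟨ht₀.le, ht₀T⟩
  have hbdd : BddAbove T := by
    have hev := (EReal.tendsto_nhds_top_iff_real.1 h.1.coercive) (c₀ + 1)
    obtain ⟨R, hR⟩ := (Metric.closedBall_compl_subset_of_mem_cocompact hev (0 : E n))
    refine ⟨R, fun t ht => ?_⟩
    by_contra! hRt
    have hx : EuclideanSpace.single i t ∈ (Metric.closedBall (0 : E n) R)ᶜ := by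
      have := ht.1
      simp [abs_of_nonneg this, hRt]
    have : ((c₀ + 1 : ℝ) : EReal) < Φ (EuclideanSpace.single i t) := hR hx
    exact absurd ht.2 (not_le.2 this)
  -- The supremum need not be attained, so only `r / 2` and `2 r` are compared with the level; hence
  -- the slack in `isNormalized_of_axis`.
  set r := sSup T with hr
  have hr0 : 0 < r := ht₀.trans_le (le_csSup hbdd hmem)
  obtain ⟨t, htT, ht⟩ := exists_lt_of_lt_csSup ⟨t₀, hmem⟩ (half_lt_self hr0)
  have hle : Φ (EuclideanSpace.single i (r / 2)) ≤ ((c₀ + 1 : ℝ) : EReal) := by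
    refine (h.1.convex.le_of_abs_le h.2 fun k => ?_).trans htT.2
    by_cases hk : k = i
    · subst hk
      have := htT.1
      simp only [PiLp.single_apply, if_true]
      rw [abs_of_pos (half_pos hr0), abs_of_nonneg this]
      exact ht.le
    · simp [hk]
  have hge : ((c₀ + 1 : ℝ) : EReal) ≤ Φ (EuclideanSpace.single i (r * 2)) := by
    by_contra! hcon
    have : r * 2 ≤ r := le_csSup hbdd ⟨by positivity, hcon.le⟩
    linarith
  refine ⟨r, hr0, -c₀, ?_⟩
  refine isNormalized_of_axis hn ?_ ⟨fun ε hε x => ?_, fun σ x => ?_⟩ ?_ (fun x => ?_) i ?_ ?_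
  · refine isConvexFun_of_lt fun x y c d a b hx hy ha hb hab => ?_
    have hs : ∀ (z : EReal) (e : ℝ), z + ((-c₀ : ℝ) : EReal) ≤ e ↔ z ≤ ((e + c₀ : ℝ) : EReal) := by
      intro z e
      rw [EReal.coe_neg, ← sub_eq_add_neg, EReal.sub_le_iff_le_add (by simp) (by simp),
        EReal.coe_add]
    have := (h.1.convex.comp_smul r).le_of_le ((hs _ _).1 hx.le) ((hs _ _).1 hy.le) ha hb hab
    rw [hs]
    refine this.trans (le_of_eq ?_)
    norm_cast
    linear_combination c₀ * hab
  · have : r • (WithLp.toLp 2 fun i => ε i * x i : E n) =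
        WithLp.toLp 2 fun i => ε i * (r • x) i := by
      ext k
      simp [mul_left_comm]
    beta_reduce
    rw [this, h.2.1 ε hε]
  · have : r • (WithLp.toLp 2 fun i => x (σ i) : E n) = WithLp.toLp 2 fun i => (r • x) (σ i) := by
      ext k
      simp
    beta_reduce
    rw [this, h.2.2 σ]
  · rw [smul_zero, hc₀]; norm_cast; simp
  · have h1 := h.1.apply_zero_le (r • x)
    rw [hc₀] at h1
    have := add_le_add_left h1 ((-c₀ : ℝ) : EReal)
    refine le_trans (le_of_eq ?_) this
    norm_cast
    simp
  · have : r • EuclideanSpace.single i (1 / 2 : ℝ) = EuclideanSpace.single i (r / 2) := by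
      ext k; by_cases hk : k = i <;> simp [hk, div_eq_mul_inv]
    rw [this]
    refine (add_le_add_left hle _).trans (le_of_eq ?_)
    norm_cast
    ring
  · have : r • EuclideanSpace.single i (2 : ℝ) = EuclideanSpace.single i (r * 2) := by
      ext k; by_cases hk : k = i <;> simp [hk]
    rw [this]
    refine le_trans (le_of_eq ?_) (add_le_add_left hge _)
    norm_cast
    ring

/-! ### The functional attached to a pair of measures -/

/-- The functional `(∫ e^{-αΦ} dμ)^{1/α} (∫ e^{-βΦ*} dν)^{1/β}`. -/
noncomputable def BSMeasure (α β : ℝ) (μ ν : Measure (E n)) (Φ : E n → EReal) : ENNReal :=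
  (∫⁻ x, expNeg α (Φ x) ∂μ) ^ (1 / α) * (∫⁻ y, expNeg β (legendre Φ y) ∂ν) ^ (1 / β)

/-- Only this half of the scaling identity is needed, as the functional must merely not decrease
under normalization. -/
theorem legendre_smul_add_le {Φ : E n → EReal} (h : ∀ x, Φ x ≠ ⊥) {r : ℝ} (hr : 0 < r) (c : ℝ)
    (y : E n) : legendre (fun x => Φ (r • x) + (c : EReal)) y ≤
      legendre Φ (r⁻¹ • y) + ((-c : ℝ) : EReal) := by
  refine iSup_le fun x => ?_
  beta_reduce
  refine le_trans (le_of_eq ?_) (add_le_add_left (le_legendre Φ (r • x) (r⁻¹ • y)) _)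
  rw [real_inner_smul_left, real_inner_smul_right, mul_inv_cancel_left₀ hr.ne']
  induction hv : Φ (r • x) with
  | bot => exact absurd hv (h _)
  | top => simp
  | coe v => norm_cast; ring

theorem BSMeasure_le_normalized {α β a b : ℝ} {μ ν : Measure (E n)} (hα : 0 < α) (hβ : 0 < β)
    (hab : a / α = b / β) (hμ : IsHomogeneousMeasure a μ) (hν : IsHomogeneousMeasure b ν)
    {Φ : E n → EReal} (h : ∀ x, Φ x ≠ ⊥) {r : ℝ} (hr : 0 < r) (c : ℝ) :
    BSMeasure α β μ ν Φ ≤ BSMeasure α β μ ν fun x => Φ (r • x) + (c : EReal) := by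
  have h1 : ∫⁻ x, expNeg α (Φ (r • x) + (c : EReal)) ∂μ =
      ENNReal.ofReal (Real.exp (-(α * c)) * r ^ (-a)) * ∫⁻ x, expNeg α (Φ x) ∂μ := by
    simp_rw [expNeg_add_coe hα]
    rw [lintegral_mul_const' _ _ ENNReal.ofReal_ne_top,
      hμ.lintegral_comp_smul hr (fun x => expNeg α (Φ x)),
      ENNReal.ofReal_mul (Real.exp_nonneg _), mul_comm, mul_assoc]
  have h2 : ENNReal.ofReal (Real.exp (β * c) * r ^ b) * ∫⁻ y, expNeg β (legendre Φ y) ∂ν ≤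
      ∫⁻ y, expNeg β (legendre (fun x => Φ (r • x) + (c : EReal)) y) ∂ν := by
    refine le_trans (le_of_eq ?_)
      (lintegral_mono fun y => expNeg_antitone hβ.le (legendre_smul_add_le h hr c y))
    simp_rw [expNeg_add_coe hβ]
    rw [lintegral_mul_const' _ _ ENNReal.ofReal_ne_top,
      hν.lintegral_comp_smul (inv_pos.2 hr) (fun x => expNeg β (legendre Φ x)),
      ENNReal.ofReal_mul (Real.exp_nonneg _), mul_comm _ (ENNReal.ofReal (Real.exp _)), mul_assoc,
      Real.inv_rpow hr.le, Real.rpow_neg hr.le, inv_inv, mul_neg, neg_neg]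
  have hα' : 0 ≤ 1 / α := by positivity
  have hβ' : 0 ≤ 1 / β := by positivity
  -- The additive constant always cancels; the powers of `r` cancel exactly because `a / α = b / β`.
  have hone : (Real.exp (-(α * c)) * r ^ (-a)) ^ (1 / α) * (Real.exp (β * c) * r ^ b) ^ (1 / β) =
      1 := by
    rw [Real.mul_rpow (Real.exp_nonneg _) (by positivity),
      Real.mul_rpow (Real.exp_nonneg _) (by positivity), ← Real.exp_mul, ← Real.exp_mul,
      ← Real.rpow_mul hr.le, ← Real.rpow_mul hr.le, mul_mul_mul_comm, ← Real.exp_add,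
      ← Real.rpow_add hr]
    have e1 : -(α * c) * (1 / α) + β * c * (1 / β) = 0 := by field_simp; ring
    have e2 : -a * (1 / α) + b * (1 / β) = 0 := by
      rw [mul_one_div, mul_one_div, neg_div, hab]; ring
    rw [e1, e2]
    simp
  calc BSMeasure α β μ ν Φ
      = (ENNReal.ofReal (Real.exp (-(α * c)) * r ^ (-a)) * ∫⁻ x, expNeg α (Φ x) ∂μ) ^ (1 / α) *
        (ENNReal.ofReal (Real.exp (β * c) * r ^ b) *
          ∫⁻ y, expNeg β (legendre Φ y) ∂ν) ^ (1 / β) := by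
        rw [ENNReal.mul_rpow_of_nonneg _ _ hα', ENNReal.mul_rpow_of_nonneg _ _ hβ',
          mul_mul_mul_comm, ENNReal.ofReal_rpow_of_pos (by positivity),
          ENNReal.ofReal_rpow_of_pos (by positivity), ← ENNReal.ofReal_mul (by positivity), hone,
          ENNReal.ofReal_one, one_mul]
        rfl
    _ ≤ _ := by
        rw [← h1]
        exact mul_le_mul_right (ENNReal.rpow_le_rpow h2 hβ') _

/-! ### Limits of normalized functions -/

section Limit

variable {Φ : ℕ → E n → EReal}

/-- Limsup, unlike liminf, preserves convexity. -/
theorem IsNormalized.limsup (h : ∀ k, IsNormalized (Φ k)) :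
    IsNormalized fun x => limsup (fun k => Φ k x) atTop := by
  refine ⟨?_, ⟨fun ε hε x => ?_, fun σ x => ?_⟩, fun x => ?_, fun x hx => ?_⟩
  · refine isConvexFun_of_lt fun x y c d a b hx hy ha hb hab => ?_
    refine limsup_le_of_le (h := ?_)
    filter_upwards [eventually_lt_of_limsup_lt hx, eventually_lt_of_limsup_lt hy] with k hkx hky
    exact (h k).convex.le_of_le hkx.le hky.le ha hb hab
  · simp_rw [fun k => (h k).symm.1 ε hε x]
  · simp_rw [fun k => (h k).symm.2 σ x]
  · exact le_limsup_of_le (h := fun b hb => by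
      obtain ⟨k, hk⟩ := hb.exists
      exact ((h k).lower x).trans hk)
  · exact limsup_le_of_le (h := Eventually.of_forall fun k => (h k).upper x hx)

theorem legendre_limsup_le (Φ : ℕ → E n → EReal) (y : E n) :
    legendre (fun x => limsup (fun k => Φ k x) atTop) y ≤
      liminf (fun k => legendre (Φ k) y) atTop := by
  refine iSup_le fun x => ?_
  refine EReal.ge_of_forall_gt_iff_ge.1 fun m hm => ?_
  beta_reduce at hm
  have hlt : limsup (fun k => Φ k x) atTop < ((inner ℝ x y - m : ℝ) : EReal) := by
    generalize limsup (fun k => Φ k x) atTop = v at hm ⊢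
    induction v with
    | bot => exact EReal.bot_lt_coe _
    | top => simp at hm
    | coe v =>
      norm_cast at hm ⊢
      linarith
  refine le_liminf_of_le (h := ?_)
  filter_upwards [eventually_lt_of_limsup_lt hlt] with k hk
  refine le_trans ?_ (le_legendre (Φ k) x y)
  refine le_trans (le_of_eq ?_) (EReal.sub_le_sub le_rfl hk.le)
  norm_cast
  ring

theorem limsup_expNeg_legendre_le {β : ℝ} (hβ : 0 < β) (Φ : ℕ → E n → EReal) (y : E n) :
    limsup (fun k => expNeg β (legendre (Φ k) y)) atTop ≤
      expNeg β (legendre (fun x => limsup (fun k => Φ k x) atTop) y) := by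
  have := (expNeg_antitone hβ.le).map_liminf_of_continuousAt (F := atTop)
    (fun k => legendre (Φ k) y) (continuous_expNeg hβ).continuousAt
  exact this.symm.trans_le (expNeg_antitone hβ.le (legendre_limsup_le Φ y))

/-- A limsup of `Φ k` controls `limsup expNeg` from the wrong side. The dilation makes room for a
rational `d` with `|x i| < d i < r |x i|`, where the sequence converges. -/
theorem limsup_expNeg_smul_le {α : ℝ} (hα : 0 < α) (h : ∀ k, IsNormalized (Φ k))
    {L : (Fin n → ℚ) → EReal}
    (hL : ∀ d, Tendsto (fun k => Φ k (WithLp.toLp 2 fun i => (d i : ℝ))) atTop (𝓝 (L d)))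
    {r : ℝ} (hr : 1 < r) {x : E n} (hx : ∀ i, x i ≠ 0) :
    limsup (fun k => expNeg α (Φ k (r • x))) atTop ≤
      expNeg α (limsup (fun k => Φ k x) atTop) := by
  have hd : ∀ i, ∃ d : ℚ, |x i| < d ∧ d < r * |x i| := fun i =>
    exists_rat_btwn (lt_mul_of_one_lt_left (abs_pos.2 (hx i)) hr)
  choose d hd1 hd2 using hd
  have hd0 : ∀ i, (0 : ℝ) ≤ d i := fun i => (abs_nonneg _).trans (hd1 i).le
  have hle : limsup (fun k => Φ k x) atTop ≤ L d := by
    rw [← (hL d).limsup_eq]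
    refine limsup_le_limsup (Eventually.of_forall fun k => ?_)
    refine (h k).convex.le_of_abs_le (h k).symm fun i => ?_
    simpa only [abs_of_nonneg (hd0 i)] using (hd1 i).le
  refine le_trans ?_ (expNeg_antitone hα.le hle)
  rw [← (((continuous_expNeg hα).tendsto _).comp (hL d)).limsup_eq]
  refine limsup_le_limsup (Eventually.of_forall fun k => expNeg_antitone hα.le ?_)
  refine (h k).convex.le_of_abs_le (h k).symm fun i => ?_
  simp only [abs_of_nonneg (hd0 i), PiLp.smul_apply, smul_eq_mul, abs_mul]
  rw [abs_of_pos (by linarith)]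
  exact (hd2 i).le

end Limit

theorem limsup_lintegral_le_of_aemeasurable {X : Type*} [MeasurableSpace X] {μ : Measure X}
    {f : ℕ → X → ENNReal} (g : X → ENNReal) (hf : ∀ k, AEMeasurable (f k) μ)
    (hbound : ∀ k x, f k x ≤ g x) (hg : ∫⁻ x, g x ∂μ ≠ ⊤) :
    limsup (fun k => ∫⁻ x, f k x ∂μ) atTop ≤ ∫⁻ x, limsup (fun k => f k x) atTop ∂μ := by
  have hae : ∀ᵐ x ∂μ, ∀ k, f k x = (hf k).mk (f k) x := ae_all_iff.2 fun k => (hf k).ae_eq_mk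
  have := limsup_lintegral_le g (fun k => (hf k).measurable_mk)
    (fun k => by filter_upwards [hae] with x hx using (hx k).symm.trans_le (hbound k x)) hg
  simp_rw [fun k => lintegral_congr_ae (hf k).ae_eq_mk]
  refine this.trans (lintegral_mono_ae ?_)
  filter_upwards [hae] with x hx
  simp_rw [hx]
  exact le_rfl

/-! ### Integrability bounds for normalized functions -/

theorem lintegral_expNeg_lower_lt_top {a α : ℝ} {μ : Measure (E n)} (hn : 0 < n) (hα : 0 < α)
    (hμ : IsHomogeneousMeasure a μ) (hfin : μ (Metric.closedBall 0 1) < ⊤) :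
    ∫⁻ x, expNeg α ((normConst n * ‖x‖ - 1 : ℝ) : EReal) ∂μ < ⊤ := by
  have : ∀ x : E n, expNeg α ((normConst n * ‖x‖ - 1 : ℝ) : EReal) =
      ENNReal.ofReal (Real.exp α) *
        ENNReal.ofReal (Real.exp (-((α * normConst n) * ‖x‖))) := by
    intro x
    rw [expNeg_coe, ← ENNReal.ofReal_mul (Real.exp_nonneg _), ← Real.exp_add]
    congr 2
    ring
  simp_rw [this]
  rw [lintegral_const_mul' _ _ ENNReal.ofReal_ne_top]
  exact ENNReal.mul_lt_top ENNReal.ofReal_lt_top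
    (hμ.lintegral_exp_neg_norm_lt_top hfin (mul_pos hα (normConst_pos hn)))

/-- Absolute continuity is asked of `μ` only: `legendre Φ` is Borel, so `ν` may be singular, as an
image under `∇V` can be. -/
theorem IsConvexFun.aemeasurable_expNeg {α : ℝ} (hα : 0 < α) {μ : Measure (E n)}
    (hμ : μ ≪ volume) {Φ : E n → EReal} (h : IsConvexFun Φ) :
    AEMeasurable (fun x => expNeg α (Φ x)) μ :=
  (measurable_expNeg hα).comp_aemeasurable (h.aemeasurable.mono_ac hμ)

/-! ### Existence of maximizers -/

theorem norm_mem_classOneSymmetric :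
    (fun x : E n => ((‖x‖ : ℝ) : EReal)) ∈ classOneSymmetric n := by
  have hsymm : IsOneSymmetric fun x : E n => ((‖x‖ : ℝ) : EReal) := by
    refine ⟨fun ε hε x => ?_, fun σ x => ?_⟩
    · have : ∀ i, ‖ε i * x i‖ = ‖x i‖ := fun i => by rcases hε i with h | h <;> simp [h]
      simp only [EuclideanSpace.norm_eq, this]
    · simp only [EuclideanSpace.norm_eq, Equiv.sum_comp σ fun i => ‖x i‖ ^ 2]
  refine ⟨⟨fun x => EReal.coe_ne_bot _, ?_, fun x => by simp, ?_, ?_⟩, hsymm⟩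
  · refine isConvexFun_of_lt fun x y c d a b hx hy ha hb hab => ?_
    rw [EReal.coe_lt_coe_iff] at hx hy
    rw [EReal.coe_le_coe_iff]
    refine (norm_add_le _ _).trans ?_
    rw [norm_smul, norm_smul, Real.norm_of_nonneg ha, Real.norm_of_nonneg hb]
    gcongr
  · have : effDom (fun x : E n => ((‖x‖ : ℝ) : EReal)) = Set.univ :=
      Set.eq_univ_of_forall fun x => EReal.coe_lt_top _
    rw [this, interior_univ]
    exact Set.univ_nonempty
  · exact tendsto_top_of_le_norm (c := 1) (d := 0) one_pos fun x => by simp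

theorem legendre_norm_le {y : E n} (hy : ‖y‖ ≤ 1) :
    legendre (fun x : E n => ((‖x‖ : ℝ) : EReal)) y ≤ ((1 : ℝ) : EReal) := by
  refine iSup_le fun x => ?_
  beta_reduce
  norm_cast
  have h1 := real_inner_le_norm x y
  have h2 : ‖x‖ * ‖y‖ ≤ ‖x‖ := mul_le_of_le_one_right (norm_nonneg x) hy
  linarith

theorem mul_measure_closedBall_le_lintegral_expNeg {γ : ℝ} (hγ : 0 < γ) {μ : Measure (E n)}
    {Φ : E n → EReal} (hΦ : ∀ x, ‖x‖ ≤ 1 → Φ x ≤ ((1 : ℝ) : EReal)) :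
    expNeg γ ((1 : ℝ) : EReal) * μ (Metric.closedBall 0 1) ≤ ∫⁻ x, expNeg γ (Φ x) ∂μ := by
  rw [← lintegral_indicator_const Metric.isClosed_closedBall.measurableSet]
  refine lintegral_mono (Set.indicator_le' (fun x hx => ?_) fun _ _ => zero_le)
  exact expNeg_antitone hγ.le (hΦ x (by simpa using hx))

section Maximizers

variable {α β a b : ℝ} {μ ν : Measure (E n)}

/-- If one measure vanishes, so does the functional. Otherwise both integrals of the norm are
positive and one is infinite. -/
theorem isMaxOn_norm_of_degenerate (hα : 0 < α) (hβ : 0 < β)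
    (hμ : IsHomogeneousMeasure a μ) (hν : IsHomogeneousMeasure b ν)
    (h : ¬ (μ (Metric.closedBall 0 1) < ⊤ ∧ ν (Metric.closedBall 0 1) < ⊤)) :
    IsMaxOn (BSMeasure α β μ ν) (classOneSymmetric n) fun x => ((‖x‖ : ℝ) : EReal) := by
  intro Ψ _
  change BSMeasure α β μ ν Ψ ≤ BSMeasure α β μ ν _
  have hα' : 0 < 1 / α := by positivity
  have hβ' : 0 < 1 / β := by positivity
  by_cases hμ0 : μ (Metric.closedBall 0 1) = 0
  · simp only [BSMeasure, hμ.eq_zero hμ0, lintegral_zero_measure, ENNReal.zero_rpow_of_pos hα',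
      zero_mul, le_refl]
  by_cases hν0 : ν (Metric.closedBall 0 1) = 0
  · simp only [BSMeasure, hν.eq_zero hν0, lintegral_zero_measure, ENNReal.zero_rpow_of_pos hβ',
      mul_zero, le_refl]
  have hpos : ∀ γ : ℝ, expNeg γ ((1 : ℝ) : EReal) ≠ 0 := fun γ => by
    rw [expNeg_coe]
    simp [Real.exp_pos]
  have h1 := mul_measure_closedBall_le_lintegral_expNeg hα (μ := μ)
    (Φ := fun x => ((‖x‖ : ℝ) : EReal)) fun x hx => by exact_mod_cast hx
  have h2 := mul_measure_closedBall_le_lintegral_expNeg hβ (μ := ν)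
    (Φ := legendre fun x : E n => ((‖x‖ : ℝ) : EReal)) fun y hy => legendre_norm_le hy
  refine le_of_le_of_eq le_top (Eq.symm ?_)
  rw [BSMeasure]
  have h1' : ∫⁻ x, expNeg α ((‖x‖ : ℝ) : EReal) ∂μ ≠ 0 := fun h0 => by
    rw [h0, nonpos_iff_eq_zero, mul_eq_zero] at h1
    exact h1.elim (hpos α) hμ0
  have h2' : ∫⁻ y, expNeg β (legendre (fun x : E n => ((‖x‖ : ℝ) : EReal)) y) ∂ν ≠ 0 :=
    fun h0 => by
      rw [h0, nonpos_iff_eq_zero, mul_eq_zero] at h2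
      exact h2.elim (hpos β) hν0
  rw [ENNReal.mul_eq_top, ENNReal.rpow_eq_top_iff_of_pos hα', ENNReal.rpow_eq_top_iff_of_pos hβ',
    Ne, Ne, ENNReal.rpow_eq_zero_iff_of_pos hα', ENNReal.rpow_eq_zero_iff_of_pos hβ']
  rw [not_and_or, not_lt_top_iff, not_lt_top_iff] at h
  rcases h with h | h
  · rw [h, ENNReal.mul_top (hpos α), top_le_iff] at h1
    exact .inr ⟨h1, h2'⟩
  · rw [h, ENNReal.mul_top (hpos β), top_le_iff] at h2
    exact .inl ⟨h1', h2⟩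

/-- Upper semicontinuity of the functional along sequences of normalized functions. -/
theorem exists_isNormalized_le_BSMeasure (hn : 0 < n) (hα : 0 < α) (hβ : 0 < β)
    (hμac : μ ≪ volume) (hμ : IsHomogeneousMeasure a μ) (hν : IsHomogeneousMeasure b ν)
    (hμfin : μ (Metric.closedBall 0 1) < ⊤) (hνfin : ν (Metric.closedBall 0 1) < ⊤)
    {Φ : ℕ → E n → EReal} (hΦ : ∀ k, IsNormalized (Φ k)) {S : ENNReal}
    (hS : Tendsto (fun k => BSMeasure α β μ ν (Φ k)) atTop (𝓝 S)) :
    ∃ Φ₀ : E n → EReal, IsNormalized Φ₀ ∧ S ≤ BSMeasure α β μ ν Φ₀ := by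
  -- A countable product of compact metrizable spaces is sequentially compact, so one extraction
  -- handles all rational points and both integrals.
  obtain ⟨⟨L, A, B⟩, φ, hφ, hlim⟩ := CompactSpace.tendsto_subseq
    (X := ((Fin n → ℚ) → EReal) × ENNReal × ENNReal)
    fun k => (fun d => Φ k (WithLp.toLp 2 fun i => (d i : ℝ)),
      ∫⁻ x, expNeg α (Φ k x) ∂μ, ∫⁻ y, expNeg β (legendre (Φ k) y) ∂ν)
  rw [nhds_prod_eq, tendsto_prod_iff', nhds_prod_eq, tendsto_prod_iff', tendsto_pi_nhds] at hlim
  obtain ⟨hL, hA, hB⟩ := hlim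
  simp only [Function.comp_def] at hL hA hB
  have hN := fun k => hΦ (φ k)
  set Φ₀ : E n → EReal := fun x => limsup (fun k => Φ (φ k) x) atTop with hΦ₀
  have hΦ₀N : IsNormalized Φ₀ := IsNormalized.limsup hN
  have hboundA := lintegral_expNeg_lower_lt_top hn hα hμ hμfin
  have hboundB := lintegral_expNeg_lower_lt_top hn hβ hν hνfin
  have hA₀ : ∫⁻ x, expNeg α (Φ₀ x) ∂μ < ⊤ :=
    (lintegral_mono fun x => expNeg_antitone hα.le (hΦ₀N.lower x)).trans_lt hboundA
  have hB₀ : ∫⁻ y, expNeg β (legendre Φ₀ y) ∂ν < ⊤ :=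
    (lintegral_mono fun y => expNeg_antitone hβ.le (hΦ₀N.le_legendre hn y)).trans_lt hboundB
  have hBle : B ≤ ∫⁻ y, expNeg β (legendre Φ₀ y) ∂ν := by
    rw [← hB.limsup_eq]
    refine (limsup_lintegral_le_of_aemeasurable
      (fun y => expNeg β ((normConst n * ‖y‖ - 1 : ℝ) : EReal))
      (fun k => ((measurable_expNeg hβ).comp (measurable_legendre _)).aemeasurable)
      (fun k y => expNeg_antitone hβ.le ((hN k).le_legendre hn y)) hboundB.ne).trans ?_
    exact lintegral_mono fun y => limsup_expNeg_legendre_le hβ (fun k => Φ (φ k)) y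
  have hAr : ∀ r : ℝ, 1 < r → ENNReal.ofReal (r ^ (-a)) * A ≤ ∫⁻ x, expNeg α (Φ₀ x) ∂μ := by
    intro r hr
    have hr0 : 0 < r := by linarith
    have hlimr : Tendsto (fun k => ∫⁻ x, expNeg α (Φ (φ k) (r • x)) ∂μ) atTop
        (𝓝 (ENNReal.ofReal (r ^ (-a)) * A)) := by
      simp_rw [fun k => hμ.lintegral_comp_smul hr0 fun x => expNeg α (Φ (φ k) x)]
      exact ENNReal.Tendsto.const_mul hA (.inr ENNReal.ofReal_ne_top)
    rw [← hlimr.limsup_eq]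
    refine (limsup_lintegral_le_of_aemeasurable
      (fun x => expNeg α ((normConst n * ‖x‖ - 1 : ℝ) : EReal))
      (fun k => ((hN k).convex.comp_smul r).aemeasurable_expNeg hα hμac)
      (fun k x => expNeg_antitone hα.le (le_trans ?_ ((hN k).lower (r • x)))) hboundA.ne).trans ?_
    · rw [norm_smul, Real.norm_of_nonneg hr0.le]
      have h1 : ‖x‖ ≤ r * ‖x‖ := le_mul_of_one_le_left (norm_nonneg x) hr.le
      have h2 := normConst_pos hn
      norm_cast
      gcongr
    · refine lintegral_mono_ae ?_
      filter_upwards [hμac.ae_le (ae_forall_apply_ne_zero (n := n))] with x hx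
      exact limsup_expNeg_smul_le hα hN hL hr hx
  have hAle : A ≤ ∫⁻ x, expNeg α (Φ₀ x) ∂μ := by
    have hc : Tendsto (fun r : ℝ => ENNReal.ofReal (r ^ (-a)) * A) (𝓝[>] 1) (𝓝 A) := by
      have h1 : Tendsto (fun r : ℝ => ENNReal.ofReal (r ^ (-a))) (𝓝[>] 1) (𝓝 1) := by
        have : ContinuousAt (fun r : ℝ => r ^ (-a)) 1 :=
          Real.continuousAt_rpow_const _ _ (.inl one_ne_zero)
        have := (ENNReal.continuous_ofReal.tendsto _).comp this.tendsto
        simpa [Function.comp_def] using this.mono_left nhdsWithin_le_nhds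
      simpa using ENNReal.Tendsto.mul_const (b := A) h1 (.inl one_ne_zero)
    exact le_of_tendsto hc (by filter_upwards [self_mem_nhdsWithin] with r hr using hAr r hr)
  refine ⟨Φ₀, hΦ₀N, ?_⟩
  have hα' : 0 ≤ 1 / α := by positivity
  have hβ' : 0 ≤ 1 / β := by positivity
  -- Finiteness of `A` and `B` excludes `0 · ∞` in the limit of the product.
  have hlim : Tendsto (fun k => BSMeasure α β μ ν (Φ (φ k))) atTop
      (𝓝 (A ^ (1 / α) * B ^ (1 / β))) :=
    ENNReal.Tendsto.mul ((ENNReal.continuous_rpow_const.tendsto _).comp hA)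
      (.inr (ENNReal.rpow_ne_top_of_nonneg hβ' (hBle.trans_lt hB₀).ne))
      ((ENNReal.continuous_rpow_const.tendsto _).comp hB)
      (.inr (ENNReal.rpow_ne_top_of_nonneg hα' (hAle.trans_lt hA₀).ne))
  rw [tendsto_nhds_unique (hS.comp hφ.tendsto_atTop) hlim]
  exact mul_le_mul' (ENNReal.rpow_le_rpow hAle hα') (ENNReal.rpow_le_rpow hBle hβ')

/-- The functional attached to a pair of homogeneous measures attains its maximum on the
`1`-symmetric functions. -/
theorem exists_isMaxOn_BSMeasure (hn : 0 < n) (hα : 0 < α) (hβ : 0 < β) (hab : a / α = b / β)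
    (hμac : μ ≪ volume) (hμ : IsHomogeneousMeasure a μ) (hν : IsHomogeneousMeasure b ν) :
    ∃ Φ ∈ classOneSymmetric n, IsMaxOn (BSMeasure α β μ ν) (classOneSymmetric n) Φ ∧
      (μ (Metric.closedBall 0 1) < ⊤ → ν (Metric.closedBall 0 1) < ⊤ →
        BSMeasure α β μ ν Φ < ⊤) := by
  by_cases hfin : μ (Metric.closedBall 0 1) < ⊤ ∧ ν (Metric.closedBall 0 1) < ⊤
  swap
  · exact ⟨_, norm_mem_classOneSymmetric, isMaxOn_norm_of_degenerate hα hβ hμ hν hfin,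
      fun h1 h2 => absurd ⟨h1, h2⟩ hfin⟩
  obtain ⟨hμfin, hνfin⟩ := hfin
  set K : Set ENNReal := BSMeasure α β μ ν '' {Φ | IsNormalized Φ} with hK
  have hKne : K.Nonempty := by
    obtain ⟨r, -, c, h⟩ := exists_isNormalized hn (norm_mem_classOneSymmetric (n := n))
    exact ⟨_, _, h, rfl⟩
  obtain ⟨u, -, hu, huK⟩ := exists_seq_tendsto_sSup hKne (OrderTop.bddAbove K)
  choose Φ hΦ hΦu using huK
  obtain ⟨Φ₀, hΦ₀, hS⟩ := exists_isNormalized_le_BSMeasure (S := sSup K) hn hα hβ hμac hμ hν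
    hμfin hνfin hΦ (by simpa only [hΦu] using hu)
  refine ⟨Φ₀, hΦ₀.mem hn, fun Ψ hΨ => ?_, fun _ _ => ?_⟩
  · change BSMeasure α β μ ν Ψ ≤ BSMeasure α β μ ν Φ₀
    obtain ⟨r, hr, c, h⟩ := exists_isNormalized hn hΨ
    exact (BSMeasure_le_normalized hα hβ hab hμ hν hΨ.1.ne_bot hr c).trans
      ((le_sSup (Set.mem_image_of_mem _ h)).trans hS)
  · refine ENNReal.mul_lt_top (ENNReal.rpow_lt_top_of_nonneg (by positivity) (ne_of_lt ?_))
      (ENNReal.rpow_lt_top_of_nonneg (by positivity) (ne_of_lt ?_))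
    · exact (lintegral_mono fun x => expNeg_antitone hα.le (hΦ₀.lower x)).trans_lt
        (lintegral_expNeg_lower_lt_top hn hα hμ hμfin)
    · exact (lintegral_mono fun y => expNeg_antitone hβ.le (hΦ₀.le_legendre hn y)).trans_lt
        (lintegral_expNeg_lower_lt_top hn hβ hν hνfin)

end Maximizers

/-! ### Reduction of `BS` and `BSV` to `BSMeasure` -/

theorem withDensity_closedBall_lt_top {ρ : E n → ℝ} (h : LocallyIntegrable ρ volume) :
    (volume : Measure (E n)).withDensity (fun x => ENNReal.ofReal (ρ x))
      (Metric.closedBall 0 1) < ⊤ := by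
  rw [withDensity_apply _ Metric.isClosed_closedBall.measurableSet]
  exact (h.integrableOn_isCompact (isCompact_closedBall 0 1)).lintegral_lt_top

theorem BS_eq_BSMeasure {α β : ℝ} (hα : 0 < α) (hβ : 0 < β) {ρ₁ ρ₂ : E n → ℝ}
    (h₁ : AEMeasurable ρ₁ volume) (h₂ : AEMeasurable ρ₂ volume) {Φ : E n → EReal}
    (hΦ : IsConvexFun Φ) :
    BS α β ρ₁ ρ₂ Φ = BSMeasure α β (volume.withDensity fun x => ENNReal.ofReal (ρ₁ x))
      (volume.withDensity fun x => ENNReal.ofReal (ρ₂ x)) Φ := by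
  rw [BS, BSMeasure, lintegral_withDensity_eq_lintegral_mul₀ h₁.ennreal_ofReal
      (hΦ.aemeasurable_expNeg hα Measure.AbsolutelyContinuous.rfl),
    lintegral_withDensity_eq_lintegral_mul₀ h₂.ennreal_ofReal
      (g := fun y => expNeg β (legendre Φ y))
      ((measurable_expNeg hβ).comp (measurable_legendre Φ)).aemeasurable]
  simp only [Pi.mul_apply, expNeg, mul_comm]

theorem BSV_eq_BSMeasure {p : ℝ} (hp : 1 < p) (V : E n → ℝ) (Φ : E n → EReal) :
    BSV p V Φ = BSMeasure 1 (1 / (p - 1)) volume (volume.map (gradient V)) Φ := by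
  rw [BSV, BSMeasure, lintegral_map (f := fun y => expNeg (1 / (p - 1)) (legendre Φ y))
    ((measurable_expNeg (one_div_pos.2 (sub_pos.2 hp))).comp (measurable_legendre Φ))
    (measurable_gradient V)]
  simp [expNeg]

end BlaschkeSantalo

theorem mainTheorem12 (n : ℕ) (hn : 0 < n) :
    (∀ (α β s t : ℝ) (ρ₁ ρ₂ : BlaschkeSantalo.E n → ℝ),
      0 < α → 0 < β → -(n : ℝ) < s → -(n : ℝ) < t →
      AEMeasurable ρ₁ volume → AEMeasurable ρ₂ volume →
      (∀ x, 0 ≤ ρ₁ x) → (∀ x, 0 ≤ ρ₂ x) →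
      BlaschkeSantalo.IsHomogeneousOfDegree s ρ₁ →
      BlaschkeSantalo.IsHomogeneousOfDegree t ρ₂ →
      α / β = ((n : ℝ) + s) / ((n : ℝ) + t) →
      ∃ Φ ∈ BlaschkeSantalo.classOneSymmetric n,
        IsMaxOn (BlaschkeSantalo.BS α β ρ₁ ρ₂) (BlaschkeSantalo.classOneSymmetric n) Φ ∧
        (LocallyIntegrable ρ₁ volume → LocallyIntegrable ρ₂ volume →
          BlaschkeSantalo.BS α β ρ₁ ρ₂ Φ < ⊤)) ∧
    (∀ (p : ℝ) (V : BlaschkeSantalo.E n → ℝ),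
      1 < p → ConvexOn ℝ Set.univ V → BlaschkeSantalo.IsHomogeneousOfDegree p V →
      ∃ Φ ∈ BlaschkeSantalo.classOneSymmetric n,
        IsMaxOn (BlaschkeSantalo.BSV p V) (BlaschkeSantalo.classOneSymmetric n) Φ ∧
        ((∀ x, x ≠ 0 → 0 < V x) → BlaschkeSantalo.BSV p V Φ < ⊤)) := by
  open BlaschkeSantalo in
  constructor
  · intro α β s t ρ₁ ρ₂ hα hβ hs ht h₁ h₂ _ _ hρ₁ hρ₂ hαβ
    have hab : ((n : ℝ) + s) / α = ((n : ℝ) + t) / β := by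
      have : (n : ℝ) + t ≠ 0 := by linarith
      rw [div_eq_div_iff hβ.ne' this] at hαβ
      rw [div_eq_div_iff hα.ne' hβ.ne']
      linarith
    obtain ⟨Φ, hΦ, hmax, hfin⟩ := exists_isMaxOn_BSMeasure hn hα hβ hab
      (withDensity_absolutelyContinuous _ _) (isHomogeneousMeasure_withDensity hn hρ₁)
      (isHomogeneousMeasure_withDensity hn hρ₂)
    refine ⟨Φ, hΦ, fun Ψ hΨ => ?_, fun hl₁ hl₂ => ?_⟩
    · change BS α β ρ₁ ρ₂ Ψ ≤ BS α β ρ₁ ρ₂ Φ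
      rw [BS_eq_BSMeasure hα hβ h₁ h₂ hΨ.1.convex, BS_eq_BSMeasure hα hβ h₁ h₂ hΦ.1.convex]
      exact hmax hΨ
    · rw [BS_eq_BSMeasure hα hβ h₁ h₂ hΦ.1.convex]
      exact hfin (withDensity_closedBall_lt_top hl₁) (withDensity_closedBall_lt_top hl₂)
  · intro p V hp hV hhom
    have hp1 : 0 < p - 1 := sub_pos.2 hp
    obtain ⟨Φ, hΦ, hmax, hfin⟩ := exists_isMaxOn_BSMeasure hn one_pos
      (one_div_pos.2 hp1) (a := n) (b := n / (p - 1)) (by field_simp)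
      Measure.AbsolutelyContinuous.rfl isHomogeneousMeasure_volume
      (isHomogeneousMeasure_map_gradient hn hp hV hhom)
    refine ⟨Φ, hΦ, fun Ψ hΨ => ?_, fun hpos => ?_⟩
    · change BSV p V Ψ ≤ BSV p V Φ
      rw [BSV_eq_BSMeasure hp, BSV_eq_BSMeasure hp]
      exact hmax hΨ
    · rw [BSV_eq_BSMeasure hp]
      exact hfin (isCompact_closedBall _ _).measure_lt_top
        (map_gradient_closedBall_lt_top hn hp hV hhom hpos)
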